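/- Let $\mathbf H^3=\mathbf C\times(0,\infty)$ be hyperbolic $3$-space in the upper half-space model, with ideal boundary the Riemann sphere $\mathbf S=\mathbf C\cup\{\infty\}$. A *nice lattice* is a group $\Gamma$ of isometries of $\mathbf H^3$ that acts freely and properly discontinuously with compact quotient; its elements extend continuously to homeomorphisms of $\mathbf S$. Let $H:\mathbf H^3\to\mathbf H^3$ be a bi-Lipschitz bijection and let $h:\mathbf S\to\mathbf S$ be a homeomorphism which extends $H$ continuously. Suppose that the pair $(H,h)$ is equivariant, that is, there are nice lattices $\Gamma_1,\Gamma_2$ such that $H\Gamma_1H^{-1}=\Gamma_2$ on $\mathbf H^3$ and $h\Gamma_1h^{-1}=\Gamma_2$ on $\mathbf S$. Suppose also that $h(\infty)=\infty$, so that $h$ restricts to a homeomorphism of $\mathbf C=\mathbf R^2$. For $z\in\mathbf C$ write $$\frac{\partial h}{\partial x}(z)=\lim_{t\to 0,\ t\in\mathbf R}\frac{h(z+t)-h(z)}{t}$$ when this limit exists in $\mathbf C$. Then the set of points of $[0,1]^2$ where $\partial h/\partial x$ does not exist is null (has Lebesgue measure zero), and the set of points of $[0,1]^2$ where $\partial h/\partial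 x$ exists and is nonzero is fat (is not null, that is, has positive Lebesgue outer measure). -/

import Mathlib

open Filter Topology MeasureTheory

noncomputable section

/-- Hyperbolic 3-space in the upper half-space model: pairs `(z, t)` with `z ∈ ℂ`, `t > 0`. -/
@[ext]
structure H3 where
  z : ℂ
  t : ℝ
  t_pos : 0 < t

namespace H3

/-- The point `(z, t)` in the Euclidean space `ℂ × ℝ` (with the `L²` norm). -/
def toEuclidean (p : H3) : WithLp 2 (ℂ × ℝ) := WithLp.toLp 2 (p.z, p.t)

/-- The mirror image `(z, -t)` of the point `(z, t)`; only used in the triangle inequality. -/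
def mirror (p : H3) : WithLp 2 (ℂ × ℝ) := WithLp.toLp 2 (p.z, -p.t)

/-- The hyperbolic distance: `sinh (d(p,q)/2) = |p - q| / (2 √(p.t * q.t))`, where `|p - q|` is the
Euclidean distance, equivalently `cosh d(p,q) = 1 + |p - q|² / (2 p.t q.t)`. -/
instance : Dist H3 :=
  ⟨fun p q => 2 * Real.arsinh
    (√(‖p.z - q.z‖ ^ 2 + (p.t - q.t) ^ 2) / (2 * √(p.t * q.t)))⟩

theorem dist_def (p q : H3) : dist p q = 2 * Real.arsinh
    (√(‖p.z - q.z‖ ^ 2 + (p.t - q.t) ^ 2) / (2 * √(p.t * q.t))) := rfl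

theorem dist_toEuclidean (p q : H3) :
    dist p.toEuclidean q.toEuclidean = √(‖p.z - q.z‖ ^ 2 + (p.t - q.t) ^ 2) := by
  rw [WithLp.prod_dist_eq_of_L2]
  simp [toEuclidean, dist_eq_norm]

theorem dist_mirror (p q : H3) :
    dist p.toEuclidean q.mirror = √(‖p.z - q.z‖ ^ 2 + (p.t + q.t) ^ 2) := by
  rw [WithLp.prod_dist_eq_of_L2]
  simp [toEuclidean, mirror, dist_eq_norm]

theorem sinh_half_dist (p q : H3) : Real.sinh (dist p q / 2) =
    dist p.toEuclidean q.toEuclidean / (2 * √(p.t * q.t)) := by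
  rw [dist_toEuclidean, dist_def, mul_div_cancel_left₀ _ two_ne_zero, Real.sinh_arsinh]

theorem cosh_half_dist (p q : H3) : Real.cosh (dist p q / 2) =
    dist p.toEuclidean q.mirror / (2 * √(p.t * q.t)) := by
  have hp := p.t_pos
  have hq := q.t_pos
  rw [← sq_eq_sq₀ (Real.cosh_pos _).le (by positivity), Real.cosh_sq', sinh_half_dist,
    dist_toEuclidean, dist_mirror, div_pow, div_pow, mul_pow, Real.sq_sqrt (by positivity),
    Real.sq_sqrt (by positivity), Real.sq_sqrt (by positivity)]
  field_simp
  ring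

theorem dist_symm (p q : H3) : dist p q = dist q p := by
  simp only [dist_def, norm_sub_rev p.z q.z, mul_comm p.t q.t, ← neg_sub q.t p.t, neg_sq]

theorem dist_tri (a b c : H3) : dist a c ≤ dist a b + dist b c := by
  have ha := a.t_pos
  have hb := b.t_pos
  have hc := c.t_pos
  have key := EuclideanGeometry.mul_dist_le_mul_dist_add_mul_dist
    a.toEuclidean b.toEuclidean c.toEuclidean b.mirror
  have hbb : dist b.toEuclidean b.mirror = 2 * b.t := by
    rw [dist_mirror, sub_self, norm_zero, show (0 : ℝ) ^ 2 + (b.t + b.t) ^ 2 = (2 * b.t) ^ 2 by ring,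
      Real.sqrt_sq (by positivity)]
  have hm : dist b.toEuclidean c.mirror = dist c.toEuclidean b.mirror := by
    rw [dist_mirror, dist_mirror, norm_sub_rev, add_comm b.t]
  rw [hbb] at key
  have h : Real.sinh (dist a c / 2) ≤ Real.sinh ((dist a b + dist b c) / 2) := by
    rw [add_div, Real.sinh_add]
    simp only [sinh_half_dist, cosh_half_dist, hm]
    rw [Real.sqrt_mul ha.le, Real.sqrt_mul ha.le, Real.sqrt_mul hb.le]
    have hb' : √b.t * √b.t = b.t := Real.mul_self_sqrt hb.le
    have ha0 := Real.sqrt_pos.2 ha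
    have hb0 := Real.sqrt_pos.2 hb
    have hc0 := Real.sqrt_pos.2 hc
    have e : dist a.toEuclidean c.toEuclidean / (2 * (√a.t * √c.t)) =
        dist a.toEuclidean c.toEuclidean * (2 * b.t) / (4 * b.t * (√a.t * √c.t)) := by
      field_simp
      ring
    rw [e, div_mul_div_comm, div_mul_div_comm,
      show 2 * (√a.t * √b.t) * (2 * (√b.t * √c.t)) = 4 * b.t * (√a.t * √c.t) by
        linear_combination (4 * √a.t * √c.t) * hb', ← add_div]
    gcongr
    linarith
  rw [Real.sinh_le_sinh] at h
  linarith

instance : MetricSpace H3 where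
  dist_self p := by simp [dist_def]
  dist_comm := dist_symm
  dist_triangle := dist_tri
  eq_of_dist_eq_zero {p q} h := by
    have hp := p.t_pos
    have hq := q.t_pos
    have h1 := sinh_half_dist p q
    rw [h, zero_div, Real.sinh_zero, eq_comm, div_eq_zero_iff] at h1
    rcases h1 with h1 | h1
    · have h2 : p.toEuclidean = q.toEuclidean := dist_eq_zero.1 h1
      have h3 : (p.z, p.t) = (q.z, q.t) := (WithLp.equiv 2 (ℂ × ℝ)).symm.injective h2
      exact H3.ext (congrArg Prod.fst h3) (congrArg Prod.snd h3)
    · have : 0 < 2 * √(p.t * q.t) := by positivity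
      exact absurd h1 this.ne'

/-- The closed upper half-space together with `∞` is a subset of the one-point compactification of
`ℂ × ℝ`; this is the inclusion of its interior. -/
def toBall (p : H3) : OnePoint (ℂ × ℝ) := ((p.z, p.t) : ℂ × ℝ)

end H3

/-- The Riemann sphere `ℂ ∪ {∞}`. -/
abbrev RiemannSphere : Type := OnePoint ℂ

/-- The Riemann sphere as the ideal boundary `(ℂ × {0}) ∪ {∞}` of hyperbolic space. -/
def RiemannSphere.toBall : RiemannSphere → OnePoint (ℂ × ℝ) := OnePoint.map fun z => (z, 0)

/-- A bi-Lipschitz map between metric spaces (bijectivity is part of the definition). -/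
def IsBL {X Y : Type*} [MetricSpace X] [MetricSpace Y] (f : X → Y) : Prop :=
  Function.Bijective f ∧ ∃ K : ℝ, 1 ≤ K ∧
    ∀ x y, K⁻¹ * dist x y ≤ dist (f x) (f y) ∧ dist (f x) (f y) ≤ K * dist x y

/-- A nice lattice: a group of isometries of hyperbolic space that acts freely and properly
discontinuously (so that the quotient is a manifold with universal covering space `H3` and deck
group `Γ`), with compact quotient. -/
structure IsNiceLattice (Γ : Subgroup (Equiv.Perm H3)) : Prop where
  isometry : ∀ γ ∈ Γ, Isometry γ
  free : ∀ γ ∈ Γ, ∀ p : H3, γ p = p → γ = 1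
  properlyDiscontinuous : ProperlyDiscontinuousSMul Γ H3
  compact_quotient : CompactSpace (MulAction.orbitRel.Quotient Γ H3)

/-- `h` extends `H` continuously to the Riemann sphere: `H p → h ξ` as `p ∈ H3` tends to the ideal
point `ξ`. -/
def IsBoundaryExtension (H : H3 → H3) (h : RiemannSphere → RiemannSphere) : Prop :=
  ∀ ξ : RiemannSphere,
    Tendsto (fun p => (H p).toBall) (comap H3.toBall (𝓝 ξ.toBall)) (𝓝 (h ξ).toBall)

/-- The homeomorphisms by which the elements of `Γ` act on the Riemann sphere. -/
def boundaryAction (Γ : Subgroup (Equiv.Perm H3)) : Set (RiemannSphere ≃ₜ RiemannSphere) :=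
  {k | ∃ γ ∈ Γ, IsBoundaryExtension γ k}

/-- `H` is a bi-Lipschitz map of hyperbolic space, the homeomorphism `h` of the Riemann sphere is
its continuous extension, and there are nice lattices `Γ₁`, `Γ₂` with `H Γ₁ H⁻¹ = Γ₂` on
hyperbolic space and `h Γ₁ h⁻¹ = Γ₂` on the Riemann sphere. -/
def IsEquivariantPair (H : Equiv.Perm H3) (h : RiemannSphere ≃ₜ RiemannSphere) : Prop :=
  IsBL H ∧ IsBoundaryExtension H h ∧
    ∃ Γ₁ Γ₂ : Subgroup (Equiv.Perm H3), IsNiceLattice Γ₁ ∧ IsNiceLattice Γ₂ ∧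
      (fun γ => H * γ * H⁻¹) '' (Γ₁ : Set (Equiv.Perm H3)) = Γ₂ ∧
      (fun k => h * k * h⁻¹) '' boundaryAction Γ₁ = boundaryAction Γ₂

/-- The unit square `[0,1]²` in the plane `ℂ`. -/
def unitSquare : Set ℂ := Set.Icc 0 1 ×ℂ Set.Icc 0 1

end

/-! The boundary map is weakly quasisymmetric, hence absolutely continuous on almost every
horizontal line; this forces both conclusions.

Quasisymmetry comes from cocompactness. Every isometry `g` can be corrected by a lattice element `γ`
so that `γ ∘ g` moves the base point boundedly, and `H γ H⁻¹` is again an isometry. Isometries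
preserve Euclidean cross-ratios, so the cross-ratios of `H ∘ g` are those of `H ∘ γ ∘ g`. These are
bounded, because `H` and `h` together embed the compact closed ball (`exists_le_chord_map`,
`exists_cross_ratio_le`). Applying this to similarities and letting three points tend to the plane
and the fourth to `∞` gives `exists_norm_sub_le`.

Absolute continuity is a length-area argument: the image of a disc has area at least a constant
times the square of its size, so chains of disjoint discs and Cauchy–Schwarz bound the variation
along a line by the area of the image of a thin strip. By differentiation of measures that area is
linear in the width of the strip for almost every line (`ae_absolutelyContinuousOnInterval`). An
absolutely continuous function is differentiable almost everywhere, and is constant if its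
derivative vanishes almost everywhere, which injectivity excludes. -/

namespace H3

/-! ### The ball model and its chordal distance -/

/-- The base point `(0, 1)`. -/
def base : H3 := ⟨0, 1, one_pos⟩

/-- The inversion about the mirror image of the base point maps the upper half-space to a ball. -/
noncomputable def toUnitBall (x : WithLp 2 (ℂ × ℝ)) : WithLp 2 (ℂ × ℝ) :=
  EuclideanGeometry.inversion base.mirror 1 x

/-- The Euclidean distance in the ball model. -/
noncomputable def chord (p q : H3) : ℝ := dist (toUnitBall p.toEuclidean) (toUnitBall q.toEuclidean)

theorem toEuclidean_ne_mirror (p : H3) : p.toEuclidean ≠ base.mirror := by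
  intro h
  have := congrArg (fun x : WithLp 2 (ℂ × ℝ) => x.snd) h
  have hp := p.t_pos
  change p.t = -1 at this
  linarith

theorem chord_eq (p q : H3) : chord p q = dist p.toEuclidean q.toEuclidean /
    (dist p.toEuclidean base.mirror * dist q.toEuclidean base.mirror) := by
  rw [chord, toUnitBall, toUnitBall, EuclideanGeometry.dist_inversion_inversion
    p.toEuclidean_ne_mirror q.toEuclidean_ne_mirror]
  ring

/-- The conformal factor of the ball model depends only on the distance to the base point. This is
what controls the effect of an isometry on `chord`. -/
theorem sinh_half_dist_eq_chord (p q : H3) : Real.sinh (dist p q / 2) =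
    2 * chord p q * Real.cosh (dist p base / 2) * Real.cosh (dist q base / 2) := by
  have hp := Real.sqrt_pos.2 p.t_pos
  have hq := Real.sqrt_pos.2 q.t_pos
  have h1 := dist_pos.2 p.toEuclidean_ne_mirror
  have h2 := dist_pos.2 q.toEuclidean_ne_mirror
  have hb : base.t = 1 := rfl
  rw [chord_eq, sinh_half_dist, cosh_half_dist, cosh_half_dist, hb, mul_one, mul_one,
    Real.sqrt_mul p.t_pos.le]
  field_simp

theorem chord_le_one (p q : H3) : chord p q ≤ 1 := by
  have h1 := Real.cosh_pos (dist p base / 2)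
  have h2 := Real.cosh_pos (dist q base / 2)
  have h : Real.sinh (dist p q / 2) ≤ Real.sinh (dist p base / 2 + dist q base / 2) := by
    rw [Real.sinh_le_sinh]
    linarith [dist_triangle_right p q base]
  rw [Real.sinh_add, sinh_half_dist_eq_chord] at h
  have h3 := Real.sinh_lt_cosh (dist p base / 2)
  have h4 := Real.sinh_lt_cosh (dist q base / 2)
  have h5 : Real.sinh (dist p base / 2) * Real.cosh (dist q base / 2) ≤
    Real.cosh (dist p base / 2) * Real.cosh (dist q base / 2) := by gcongr
  have h6 : Real.cosh (dist p base / 2) * Real.sinh (dist q base / 2) ≤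
    Real.cosh (dist p base / 2) * Real.cosh (dist q base / 2) := by gcongr
  have h7 := mul_pos h1 h2
  by_contra! hc
  nlinarith

theorem chord_nonneg (p q : H3) : 0 ≤ chord p q := dist_nonneg

/-- Used to pass from hyperbolic convergence to convergence in the ball. -/
theorem chord_le_sinh (p q : H3) : chord p q ≤ Real.sinh (dist p q / 2) := by
  rw [sinh_half_dist_eq_chord]
  have h1 := Real.one_le_cosh (dist p base / 2)
  have h2 := Real.one_le_cosh (dist q base / 2)
  have h3 := chord_nonneg p q
  have h4 : 1 ≤ Real.cosh (dist p base / 2) * Real.cosh (dist q base / 2) :=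
    one_le_mul_of_one_le_of_one_le h1 h2
  nlinarith

theorem cosh_add_le {a b : ℝ} (ha : 0 ≤ a) : Real.cosh (a + b) ≤ Real.exp a * Real.cosh b := by
  rw [Real.cosh_eq, Real.cosh_eq, neg_add, Real.exp_add, Real.exp_add]
  have h : Real.exp (-a) ≤ Real.exp a := Real.exp_le_exp.2 (by linarith)
  nlinarith [Real.exp_pos (-b), Real.exp_pos b]

/-- An isometry which moves the base point by a bounded amount is bi-Lipschitz in the ball. -/
theorem chord_le_of_isometry {g : H3 → H3} (hg : Isometry g) {R : ℝ}
    (hR : dist (g base) base ≤ R) (p q : H3) :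
    chord p q ≤ Real.exp R * chord (g p) (g q) := by
  have hR0 : 0 ≤ R := dist_nonneg.trans hR
  have key (x : H3) : Real.cosh (dist (g x) base / 2) ≤
      Real.exp (R / 2) * Real.cosh (dist x base / 2) := by
    refine le_trans ?_ (cosh_add_le (by positivity))
    rw [Real.cosh_le_cosh, abs_of_nonneg (by positivity), abs_of_nonneg (by positivity)]
    have := dist_triangle (g x) (g base) base
    rw [hg.dist_eq] at this
    linarith
  have h1 := sinh_half_dist_eq_chord p q
  have h2 := sinh_half_dist_eq_chord (g p) (g q)
  rw [hg.dist_eq, h1] at h2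
  have hp := Real.cosh_pos (dist p base / 2)
  have hq := Real.cosh_pos (dist q base / 2)
  have hc := chord_nonneg (g p) (g q)
  have h3 : chord (g p) (g q) * (Real.cosh (dist (g p) base / 2) * Real.cosh (dist (g q) base / 2)) ≤
      chord (g p) (g q) * ((Real.exp (R / 2) * Real.cosh (dist p base / 2)) *
        (Real.exp (R / 2) * Real.cosh (dist q base / 2))) := by
    gcongr
    exacts [key p, key q]
  have he : Real.exp (R / 2) * Real.exp (R / 2) = Real.exp R := by
    rw [← Real.exp_add]; ring_nf
  rw [show Real.exp (R / 2) * Real.cosh (dist p base / 2) *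
    (Real.exp (R / 2) * Real.cosh (dist q base / 2)) = Real.exp R *
      (Real.cosh (dist p base / 2) * Real.cosh (dist q base / 2)) by rw [← he]; ring] at h3
  refine le_of_mul_le_mul_right ?_ (mul_pos hp hq)
  linarith

/-! ### Compactness of the closed ball -/

/-- The inclusion of the closed ball, the disjoint union of hyperbolic space and its boundary,
in the one-point compactification of `ℂ × ℝ`. -/
def closedToBall : H3 ⊕ RiemannSphere → OnePoint (ℂ × ℝ) := Sum.elim toBall RiemannSphere.toBall

/-- The ball model of the closed ball. -/
noncomputable def closedToUnitBall : H3 ⊕ RiemannSphere → WithLp 2 (ℂ × ℝ) :=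
  Sum.elim (fun p => toUnitBall p.toEuclidean)
    (fun ξ => ξ.elim base.mirror fun z => toUnitBall (WithLp.toLp 2 (z, 0)))

theorem toUnitBall_injective : Function.Injective toUnitBall :=
  EuclideanGeometry.inversion_injective _ one_ne_zero

theorem toUnitBall_mirror : toUnitBall base.mirror = base.mirror :=
  EuclideanGeometry.inversion_self _ _

/-- By convention an inversion fixes its own centre, so it is injective on the whole space. The
centre, which lies outside the closed half-space, is thus free to be the image of `∞`. -/
theorem closedToUnitBall_injective : Function.Injective closedToUnitBall := by
  have hb (z : ℂ) : WithLp.toLp 2 (z, (0 : ℝ)) ≠ base.mirror := by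
    intro h
    have := congrArg (fun x : WithLp 2 (ℂ × ℝ) => x.snd) h
    simp [mirror, base] at this
  have hpz (p : H3) (z : ℂ) : p.toEuclidean ≠ WithLp.toLp 2 (z, (0 : ℝ)) := by
    intro h
    have := congrArg (fun x : WithLp 2 (ℂ × ℝ) => x.snd) h
    exact p.t_pos.ne' this
  have hb' (z : ℂ) : toUnitBall (WithLp.toLp 2 (z, (0 : ℝ))) ≠ base.mirror := fun h =>
    hb z (toUnitBall_injective (h.trans toUnitBall_mirror.symm))
  have hp' (p : H3) : toUnitBall p.toEuclidean ≠ base.mirror := fun h =>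
    p.toEuclidean_ne_mirror (toUnitBall_injective (h.trans toUnitBall_mirror.symm))
  rintro (p | ξ) (q | η) h
  · have h2 : p.toEuclidean = q.toEuclidean := toUnitBall_injective h
    have h3 : (p.z, p.t) = (q.z, q.t) := (WithLp.equiv 2 (ℂ × ℝ)).symm.injective h2
    exact congrArg Sum.inl (H3.ext (congrArg Prod.fst h3) (congrArg Prod.snd h3))
  · induction η using OnePoint.rec with
    | infty => exact absurd h (hp' p)
    | coe z => exact absurd (toUnitBall_injective h) (hpz p z)
  · induction ξ using OnePoint.rec with
    | infty => exact absurd h.symm (hp' q)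
    | coe z => exact absurd (toUnitBall_injective h).symm (hpz q z)
  · induction ξ using OnePoint.rec with
    | infty =>
      induction η using OnePoint.rec with
      | infty => rfl
      | coe z => exact absurd h.symm (hb' z)
    | coe w =>
      induction η using OnePoint.rec with
      | infty => exact absurd h (hb' w)
      | coe z =>
        have h2 : WithLp.toLp 2 (w, (0 : ℝ)) = WithLp.toLp 2 (z, (0 : ℝ)) := toUnitBall_injective h
        have h3 : (w, (0 : ℝ)) = (z, 0) := (WithLp.equiv 2 (ℂ × ℝ)).symm.injective h2
        rw [show w = z from congrArg Prod.fst h3]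

theorem tendsto_toUnitBall_of_tendsto_coe {α : Type*} {l : Filter α} {x : α → H3} {v : ℂ × ℝ}
    (hv : 0 ≤ v.2) (hx : Tendsto (fun a => (x a).toBall) l (𝓝 (v : OnePoint (ℂ × ℝ)))) :
    Tendsto (fun a => toUnitBall (x a).toEuclidean) l (𝓝 (toUnitBall (WithLp.toLp 2 v))) := by
  have h1 : Tendsto (fun a => ((x a).z, (x a).t)) l (𝓝 v) := by
    rw [← OnePoint.comap_coe_nhds v, tendsto_comap_iff]
    exact hx
  have h2 : Tendsto (fun a => (x a).toEuclidean) l (𝓝 (WithLp.toLp 2 v)) :=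
    ((WithLp.prod_continuous_toLp 2 ℂ ℝ).tendsto v).comp h1
  have hne : WithLp.toLp 2 v ≠ base.mirror := by
    intro h
    have := congrArg (fun x : WithLp 2 (ℂ × ℝ) => x.snd) h
    change v.2 = -1 at this
    linarith
  exact Filter.Tendsto.inversion tendsto_const_nhds tendsto_const_nhds h2 hne

theorem tendsto_norm_of_tendsto_infty {α : Type*} {l : Filter α} {x : α → H3}
    (hx : Tendsto (fun a => (x a).toBall) l (𝓝 (OnePoint.infty : OnePoint (ℂ × ℝ))))
    (c : WithLp 2 (ℂ × ℝ)) :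
    Tendsto (fun a => dist (x a).toEuclidean c) l atTop := by
  have h1 : Tendsto (fun a => ((x a).z, (x a).t)) l (cocompact (ℂ × ℝ)) := by
    rw [← Filter.coclosedCompact_eq_cocompact, ← OnePoint.comap_coe_nhds_infty, tendsto_comap_iff]
    exact hx
  have h2 : Tendsto (fun v : ℂ × ℝ => WithLp.toLp 2 v) (cocompact _) (cocompact _) :=
    ((WithLp.homeomorphProd 2 ℂ ℝ).symm.isClosedEmbedding).tendsto_cocompact
  exact (tendsto_dist_right_cocompact_atTop c).comp (h2.comp h1)

theorem tendsto_toUnitBall_of_tendsto_infty {α : Type*} {l : Filter α} {x : α → H3}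
    (hx : Tendsto (fun a => (x a).toBall) l (𝓝 (OnePoint.infty : OnePoint (ℂ × ℝ)))) :
    Tendsto (fun a => toUnitBall (x a).toEuclidean) l (𝓝 base.mirror) := by
  rw [tendsto_iff_dist_tendsto_zero]
  simp only [toUnitBall, EuclideanGeometry.dist_inversion_center]
  exact (tendsto_norm_of_tendsto_infty hx base.mirror).const_div_atTop _

theorem tendsto_closedToUnitBall {α : Type*} {l : Filter α} {x : α → H3} {ξ : H3 ⊕ RiemannSphere}
    (hx : Tendsto (fun a => (x a).toBall) l (𝓝 (closedToBall ξ))) :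
    Tendsto (fun a => toUnitBall (x a).toEuclidean) l (𝓝 (closedToUnitBall ξ)) := by
  rcases ξ with p | ξ
  · exact tendsto_toUnitBall_of_tendsto_coe p.t_pos.le hx
  · induction ξ using OnePoint.rec with
    | infty => exact tendsto_toUnitBall_of_tendsto_infty hx
    | coe z => exact tendsto_toUnitBall_of_tendsto_coe le_rfl hx

theorem tendsto_of_tendsto_toBall {α : Type*} {l : Filter α} {x : α → H3} {p : H3}
    (hx : Tendsto (fun a => (x a).toBall) l (𝓝 p.toBall)) : Tendsto x l (𝓝 p) := by
  have h1 : Tendsto (fun a => ((x a).z, (x a).t)) l (𝓝 (p.z, p.t)) := by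
    rw [← OnePoint.comap_coe_nhds, tendsto_comap_iff]
    exact hx
  have hz : Tendsto (fun a => (x a).z) l (𝓝 p.z) := (continuous_fst.tendsto _).comp h1
  have ht : Tendsto (fun a => (x a).t) l (𝓝 p.t) := (continuous_snd.tendsto _).comp h1
  rw [tendsto_iff_dist_tendsto_zero]
  simp only [dist_def]
  have hp := p.t_pos
  have h : Tendsto (fun a => √(‖(x a).z - p.z‖ ^ 2 + ((x a).t - p.t) ^ 2) /
      (2 * √((x a).t * p.t))) l
      (𝓝 (√(‖p.z - p.z‖ ^ 2 + (p.t - p.t) ^ 2) / (2 * √(p.t * p.t)))) := by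
    refine Tendsto.div ?_ ?_ (by positivity)
    · exact ((((hz.sub_const _).norm).pow 2).add ((ht.sub_const _).pow 2)).sqrt
    · exact ((ht.mul_const _).sqrt).const_mul 2
  have h' := (((Real.continuous_arsinh.tendsto _).comp h).const_mul 2)
  simpa using h'

/-- Ultrafilters on hyperbolic space converge in the closed ball. -/
theorem exists_tendsto_closedToBall {α : Type*} (U : Ultrafilter α) (x : α → H3) :
    ∃ ξ, Tendsto (fun a => (x a).toBall) U (𝓝 (closedToBall ξ)) := by
  obtain ⟨v, hv'⟩ : ∃ v, Tendsto (fun a => (x a).toBall) U (𝓝 v) :=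
    ⟨_, (U.map fun a => (x a).toBall).le_nhds_lim⟩
  induction v using OnePoint.rec with
  | infty => exact ⟨Sum.inr OnePoint.infty, hv'⟩
  | coe v =>
    have h1 : Tendsto (fun a => ((x a).z, (x a).t)) U (𝓝 v) := by
      rw [← OnePoint.comap_coe_nhds, tendsto_comap_iff]
      exact hv'
    have ht : Tendsto (fun a => (x a).t) U (𝓝 v.2) := (continuous_snd.tendsto _).comp h1
    have h0 : 0 ≤ v.2 := ge_of_tendsto ht (Eventually.of_forall fun a => (x a).t_pos.le)
    rcases h0.eq_or_lt with h0 | h0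
    · refine ⟨Sum.inr ((v.1 : ℂ) : RiemannSphere), ?_⟩
      have : closedToBall (Sum.inr ((v.1 : ℂ) : RiemannSphere)) = (v : OnePoint (ℂ × ℝ)) := by
        change (((v.1, (0 : ℝ)) : ℂ × ℝ) : OnePoint (ℂ × ℝ)) = v
        rw [h0]
      rwa [this]
    · exact ⟨Sum.inl ⟨v.1, v.2, h0⟩, hv'⟩

/-- A continuous injection of the closed ball is a uniform embedding. -/
theorem exists_le_chord_map {H : H3 → H3} {h : RiemannSphere → RiemannSphere}
    (hH : Continuous H) (hHi : Function.Injective H) (hh : Function.Injective h)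
    (hb : IsBoundaryExtension H h) {κ : ℝ} (hκ : 0 < κ) :
    ∃ κ' > 0, ∀ p q, κ ≤ chord p q → κ' ≤ chord (H p) (H q) := by
  have hF : ∀ (U : Ultrafilter ℕ) (x : ℕ → H3), ∃ ξ,
      Tendsto (fun a => toUnitBall (x a).toEuclidean) U (𝓝 (closedToUnitBall ξ)) ∧
      Tendsto (fun a => toUnitBall (H (x a)).toEuclidean) U
        (𝓝 (closedToUnitBall (Sum.map H h ξ))) := by
    intro U x
    obtain ⟨ξ, hξ⟩ := exists_tendsto_closedToBall U x
    refine ⟨ξ, tendsto_closedToUnitBall hξ, ?_⟩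
    rcases ξ with p | ξ
    · have h1 := (hH.tendsto p).comp (tendsto_of_tendsto_toBall hξ)
      rw [tendsto_iff_dist_tendsto_zero] at h1 ⊢
      have h2 : Tendsto (fun a => Real.sinh (dist (H (x a)) (H p) / 2)) U (𝓝 0) := by
        have := (Real.continuous_sinh.tendsto _).comp (h1.div_const 2)
        simpa [Function.comp_def] using this
      exact squeeze_zero (fun _ => dist_nonneg) (fun a => chord_le_sinh _ _) h2
    · refine tendsto_closedToUnitBall (ξ := Sum.inr (h ξ)) ?_
      exact (hb ξ).comp (tendsto_comap_iff.2 hξ)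
  -- Otherwise there are pairs that stay `κ` apart while their images merge. Along an ultrafilter
  -- both sequences converge in the closed ball; the limits have equal images, so they coincide,
  -- which is absurd.
  by_contra! hc
  choose x y hxy hxy' using fun n : ℕ => hc (1 / ((n : ℝ) + 1)) (by positivity)
  obtain ⟨U, hU⟩ : ∃ U : Ultrafilter ℕ, (U : Filter ℕ) ≤ atTop := Ultrafilter.exists_le atTop
  obtain ⟨ξ, h1, h2⟩ := hF U x
  obtain ⟨η, h3, h4⟩ := hF U y
  have h5 : dist (closedToUnitBall (Sum.map H h ξ)) (closedToUnitBall (Sum.map H h η)) ≤ 0 :=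
    le_of_tendsto_of_tendsto' (h2.dist h4)
      (tendsto_one_div_add_atTop_nhds_zero_nat.mono_left hU) fun n => (hxy' n).le
  have h6 : ξ = η := (hHi.sumMap hh) (closedToUnitBall_injective (dist_le_zero.1 h5))
  have h7 : κ ≤ dist (closedToUnitBall ξ) (closedToUnitBall η) :=
    ge_of_tendsto' (h1.dist h3) hxy
  rw [h6, dist_self] at h7
  exact hκ.not_ge h7

end H3

/-! ### Cocompactness and cross-ratios -/

/-- The orbit of the base point under a nice lattice is coarsely dense. -/
theorem IsNiceLattice.exists_dist_base_le {Γ : Subgroup (Equiv.Perm H3)} (hΓ : IsNiceLattice Γ) :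
    ∃ R : ℝ, ∀ p : H3, ∃ γ ∈ Γ, dist (γ p) H3.base ≤ R := by
  have := hΓ.compact_quotient
  have : ContinuousConstSMul Γ H3 := ⟨fun γ => (hΓ.isometry γ γ.2).continuous⟩
  let π : H3 → MulAction.orbitRel.Quotient Γ H3 := Quotient.mk''
  have hopen (n : ℕ) : IsOpen (π '' Metric.ball H3.base n) :=
    isOpenMap_quotient_mk'_mul _ Metric.isOpen_ball
  obtain ⟨n, hn⟩ := isCompact_univ.elim_directed_cover (fun n : ℕ => π '' Metric.ball H3.base n)
    hopen (by
      intro q _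
      induction q using Quotient.inductionOn' with
      | h p =>
        obtain ⟨n, hn⟩ := exists_nat_gt (dist p H3.base)
        exact Set.mem_iUnion.2 ⟨n, p, hn, rfl⟩)
    (Monotone.directed_le fun m n hmn =>
      Set.image_mono (Metric.ball_subset_ball (by exact_mod_cast hmn)))
  refine ⟨n, fun p => ?_⟩
  obtain ⟨q, hq, hqp⟩ := hn (Set.mem_univ (π p))
  obtain ⟨γ, hγ⟩ := (Quotient.exact hqp : MulAction.orbitRel Γ H3 q p)
  have h1 : (γ : Equiv.Perm H3) p = q := hγ
  exact ⟨γ, γ.2, h1 ▸ (Metric.mem_ball.1 hq).le⟩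

namespace H3

theorem dist_toEuclidean_eq_sinh (p q : H3) : dist p.toEuclidean q.toEuclidean =
    2 * √p.t * √q.t * Real.sinh (dist p q / 2) := by
  have hp := Real.sqrt_pos.2 p.t_pos
  have hq := Real.sqrt_pos.2 q.t_pos
  rw [sinh_half_dist, Real.sqrt_mul p.t_pos.le]
  field_simp

/-- Isometries preserve Euclidean cross-ratios. -/
theorem cross_ratio_le_of_isometry {g : H3 → H3} (hg : Isometry g) {C : ℝ} {p q r s : H3}
    (h : dist (g p).toEuclidean (g q).toEuclidean * dist (g r).toEuclidean (g s).toEuclidean ≤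
      C * (dist (g r).toEuclidean (g q).toEuclidean * dist (g p).toEuclidean (g s).toEuclidean)) :
    dist p.toEuclidean q.toEuclidean * dist r.toEuclidean s.toEuclidean ≤
      C * (dist r.toEuclidean q.toEuclidean * dist p.toEuclidean s.toEuclidean) := by
  simp only [dist_toEuclidean_eq_sinh, hg.dist_eq] at h ⊢
  -- Each of the four points occurs once in each product, so the height factors cancel and only
  -- hyperbolic distances remain.
  have key (p q r s : H3) : 0 < 4 * (√p.t * √q.t * √r.t * √s.t) := by
    have hp := Real.sqrt_pos.2 p.t_pos
    have hq := Real.sqrt_pos.2 q.t_pos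
    have hr := Real.sqrt_pos.2 r.t_pos
    have hs := Real.sqrt_pos.2 s.t_pos
    positivity
  have h2 : Real.sinh (dist p q / 2) * Real.sinh (dist r s / 2) ≤
      C * (Real.sinh (dist r q / 2) * Real.sinh (dist p s / 2)) := by
    refine le_of_mul_le_mul_left ?_ (key (g p) (g q) (g r) (g s))
    linear_combination h
  linear_combination 4 * (√p.t * √q.t * √r.t * √s.t) * h2

/-- The Euclidean cross-ratio of four points, two pairs of which are far apart in the ball. -/
theorem cross_ratio_le_of_le_chord {κ : ℝ} (hκ : 0 < κ) {p q r s : H3}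
    (h1 : κ ≤ chord r q) (h2 : κ ≤ chord p s) :
    dist p.toEuclidean q.toEuclidean * dist r.toEuclidean s.toEuclidean ≤
      (κ * κ)⁻¹ * (dist r.toEuclidean q.toEuclidean * dist p.toEuclidean s.toEuclidean) := by
  -- The factors at the four points cancel as well, so the cross-ratio may be computed with `chord`,
  -- which is at most one.
  have key (x y : H3) : dist x.toEuclidean y.toEuclidean = chord x y *
      (dist x.toEuclidean base.mirror * dist y.toEuclidean base.mirror) := by
    have hx := dist_pos.2 x.toEuclidean_ne_mirror
    have hy := dist_pos.2 y.toEuclidean_ne_mirror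
    rw [chord_eq]
    field_simp
  have h3 : chord p q * chord r s ≤ 1 :=
    mul_le_one₀ (chord_le_one _ _) (chord_nonneg _ _) (chord_le_one _ _)
  have h4 : 1 ≤ (κ * κ)⁻¹ * (chord r q * chord p s) := by
    rw [← div_eq_inv_mul, one_le_div (by positivity)]
    exact mul_le_mul h1 h2 hκ.le (chord_nonneg _ _)
  have h5 := h3.trans h4
  simp only [key]
  linear_combination (dist p.toEuclidean base.mirror * dist q.toEuclidean base.mirror *
    dist r.toEuclidean base.mirror * dist s.toEuclidean base.mirror) * h5

/-! ### Weak quasisymmetry of the boundary map -/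

/-- Similarities of the plane act on hyperbolic space. -/
def similarity (a : ℝ) (ha : 0 < a) (c : ℂ) (p : H3) : H3 :=
  ⟨a * p.z + c, a * p.t, mul_pos ha p.t_pos⟩

theorem isometry_similarity {a : ℝ} (ha : 0 < a) (c : ℂ) : Isometry (similarity a ha c) := by
  refine Isometry.of_dist_eq fun p q => ?_
  have h1 : √(‖(a : ℂ) * p.z + c - (a * q.z + c)‖ ^ 2 + (a * p.t - a * q.t) ^ 2) =
      a * √(‖p.z - q.z‖ ^ 2 + (p.t - q.t) ^ 2) := by
    rw [add_sub_add_right_eq_sub, ← mul_sub, ← mul_sub, norm_mul, mul_pow, mul_pow,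
      Complex.norm_real, Real.norm_of_nonneg ha.le, ← mul_add, Real.sqrt_mul (by positivity),
      Real.sqrt_sq ha.le]
  have h2 : √(a * p.t * (a * q.t)) = a * √(p.t * q.t) := by
    rw [show a * p.t * (a * q.t) = a ^ 2 * (p.t * q.t) by ring, Real.sqrt_mul (by positivity),
      Real.sqrt_sq ha.le]
  simp only [dist_def, similarity, h1, h2]
  congr 2
  field_simp

/-- This and the next bound treat the normalised configuration: `0`, a point on the unit circle and
one in the unit disc, all at height `ε`, and `ε⁻¹` high up in place of `∞`. Only uniformity in `ε`
matters, not the value `1 / 12`. -/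
theorem le_chord_of_norm_eq_one {u : ℂ} (hu : ‖u‖ = 1) {ε : ℝ} (h0 : 0 < ε) (h1 : ε ≤ 1 / 2) :
    1 / 12 ≤ chord ⟨u, ε, h0⟩ ⟨0, ε, h0⟩ := by
  rw [chord_eq, dist_toEuclidean, dist_mirror, dist_mirror]
  simp only [base, sub_zero, norm_zero, hu, sub_self]
  have e1 : √((1 : ℝ) ^ 2 + 0 ^ 2) = 1 := by norm_num
  have e2 : √((0 : ℝ) ^ 2 + (ε + 1) ^ 2) = ε + 1 := by
    rw [zero_pow two_ne_zero, zero_add, Real.sqrt_sq (by positivity)]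
  have e3 : √((1 : ℝ) ^ 2 + (ε + 1) ^ 2) ≤ ε + 2 := by
    rw [Real.sqrt_le_left (by positivity)]; nlinarith
  have e4 : 0 < √((1 : ℝ) ^ 2 + (ε + 1) ^ 2) := by positivity
  rw [e1, e2]
  have : √((1 : ℝ) ^ 2 + (ε + 1) ^ 2) * (ε + 1) ≤ 12 := by nlinarith
  exact one_div_le_one_div_of_le (by positivity) this

theorem le_chord_of_norm_le_one {u : ℂ} (hu : ‖u‖ ≤ 1) {ε : ℝ} (h0 : 0 < ε) (h1 : ε ≤ 1 / 2) :
    1 / 12 ≤ chord ⟨u, ε, h0⟩ ⟨0, ε⁻¹, inv_pos.2 h0⟩ := by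
  rw [chord_eq, dist_toEuclidean, dist_mirror, dist_mirror]
  simp only [base, sub_zero, norm_zero]
  have h2 : 2 ≤ ε⁻¹ := by
    rw [le_inv_comm₀ two_pos h0]; linarith
  set N := ε⁻¹
  have e1 : N / 2 ≤ √(‖u‖ ^ 2 + (ε - N) ^ 2) := by
    apply Real.le_sqrt_of_sq_le; nlinarith [sq_nonneg ‖u‖]
  have e2 : √((0 : ℝ) ^ 2 + (N + 1) ^ 2) = N + 1 := by
    rw [zero_pow two_ne_zero, zero_add, Real.sqrt_sq (by positivity)]
  have e3 : √(‖u‖ ^ 2 + (ε + 1) ^ 2) ≤ ε + 2 := by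
    rw [Real.sqrt_le_left (by positivity)]; nlinarith [norm_nonneg u]
  have e4 : 0 < √(‖u‖ ^ 2 + (ε + 1) ^ 2) := by positivity
  rw [e2, le_div_iff₀ (by positivity)]
  have : √(‖u‖ ^ 2 + (ε + 1) ^ 2) * (N + 1) ≤ (5 / 2) * (N + 1) := by gcongr; linarith
  linarith

end H3

open H3

theorem IsBL.continuous {X Y : Type*} [MetricSpace X] [MetricSpace Y] {f : X → Y} (hf : IsBL f) :
    Continuous f := by
  obtain ⟨-, K, hK, h⟩ := hf
  exact (LipschitzWith.of_dist_le_mul (K := ⟨K, by linarith⟩) fun x y => (h x y).2).continuous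

/-- The equivariance turns large scales into bounded ones. -/
theorem IsEquivariantPair.exists_cross_ratio_le {H : Equiv.Perm H3}
    {h : RiemannSphere ≃ₜ RiemannSphere} (hHh : IsEquivariantPair H h) {κ : ℝ} (hκ : 0 < κ) :
    ∃ C : ℝ, 0 ≤ C ∧ ∀ g : H3 → H3, Isometry g → ∀ p q r s : H3, κ ≤ chord r q → κ ≤ chord p s →
      dist (H (g p)).toEuclidean (H (g q)).toEuclidean *
          dist (H (g r)).toEuclidean (H (g s)).toEuclidean ≤
        C * (dist (H (g r)).toEuclidean (H (g q)).toEuclidean *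
          dist (H (g p)).toEuclidean (H (g s)).toEuclidean) := by
  obtain ⟨hBL, hb, Γ₁, Γ₂, h1, h2, h12, -⟩ := hHh
  obtain ⟨R, hR⟩ := h1.exists_dist_base_le
  obtain ⟨κ', hκ', hmap⟩ := exists_le_chord_map hBL.continuous H.injective h.injective hb
    (κ := κ / Real.exp R) (by positivity)
  refine ⟨(κ' * κ')⁻¹, by positivity, fun g hg p q r s hrq hps => ?_⟩
  obtain ⟨γ, hγ, hγR⟩ := hR (g base)
  have hk : Isometry (γ ∘ g) := (h1.isometry γ hγ).comp hg
  have hH (x : H3) : (H * γ * H⁻¹) (H x) = H (γ x) := by simp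
  have hγ₂ : Isometry (H * γ * H⁻¹) :=
    h2.isometry _ (h12.subset (Set.mem_image_of_mem (fun γ => H * γ * H⁻¹) hγ))
  have hle {x y : H3} (hxy : κ ≤ chord x y) : κ' ≤ chord (H (γ (g x))) (H (γ (g y))) := by
    refine hmap _ _ ?_
    rw [div_le_iff₀' (Real.exp_pos R)]
    exact hxy.trans (chord_le_of_isometry hk hγR x y)
  -- Equivariance enters here: `H * γ * H⁻¹` carries the points `H (g x)` to `H (γ (g x))`, whose
  -- mutual chords are controlled.
  refine cross_ratio_le_of_isometry hγ₂ ?_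
  simp only [hH]
  exact cross_ratio_le_of_le_chord hκ' (hle hrq) (hle hps)

theorem tendsto_toEuclidean_of_isBoundaryExtension {H : H3 → H3} {h : RiemannSphere → RiemannSphere}
    (hb : IsBoundaryExtension H h) {f : ℂ → ℂ}
    (hf : ∀ z : ℂ, h (z : RiemannSphere) = (f z : RiemannSphere))
    {l : Filter ℝ} (z : ℂ) {x : ℝ → H3}
    (hx : Tendsto (fun ε => ((x ε).z, (x ε).t)) l (𝓝 (z, 0))) :
    Tendsto (fun ε => (H (x ε)).toEuclidean) l (𝓝 (WithLp.toLp 2 (f z, (0 : ℝ)))) := by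
  have h1 : Tendsto x l (comap H3.toBall (𝓝 (RiemannSphere.toBall z))) :=
    tendsto_comap_iff.2 ((OnePoint.continuous_coe.tendsto _).comp hx)
  have h2 := (hb z).comp h1
  rw [hf] at h2
  have h3 : Tendsto (fun ε => ((H (x ε)).z, (H (x ε)).t)) l (𝓝 (f z, 0)) := by
    rw [← OnePoint.comap_coe_nhds, tendsto_comap_iff]
    exact h2
  exact ((WithLp.prod_continuous_toLp 2 ℂ ℝ).tendsto _).comp h3

/-- The boundary extension of an equivariant pair is weakly quasisymmetric. -/
theorem IsEquivariantPair.exists_norm_sub_le {H : Equiv.Perm H3}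
    {h : RiemannSphere ≃ₜ RiemannSphere} (hHh : IsEquivariantPair H h)
    (hinfty : h OnePoint.infty = OnePoint.infty) {f : ℂ → ℂ}
    (hf : ∀ z : ℂ, h (z : RiemannSphere) = (f z : RiemannSphere)) :
    ∃ C : ℝ, 0 ≤ C ∧ ∀ c z w : ℂ, ‖z - c‖ ≤ ‖w - c‖ → ‖f z - f c‖ ≤ C * ‖f w - f c‖ := by
  obtain ⟨C, hC0, hC⟩ := hHh.exists_cross_ratio_le (κ := 1 / 12) (by norm_num)
  refine ⟨C, hC0, fun c z w hzw => ?_⟩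
  have hb := hHh.2.1
  rcases (norm_nonneg (w - c)).eq_or_lt with ha | ha
  · rw [← ha] at hzw
    rw [sub_eq_zero.1 (norm_le_zero_iff.1 hzw), sub_self, norm_zero]
    positivity
  set a := ‖w - c‖ with ha'
  have haC : (a : ℂ) ≠ 0 := by exact_mod_cast ha.ne'
  -- points at height proportional to `ε`
  let x (ζ : ℂ) (ε : ℝ) : H3 := if h0 : 0 < ε then ⟨ζ, a * ε, mul_pos ha h0⟩ else base
  -- The point that tends to `∞`. The default `base` plays no role, as all limits are along `𝓝[>]
  -- 0`.
  let y (ε : ℝ) : H3 := if h0 : 0 < ε then ⟨c, a * ε⁻¹, mul_pos ha (inv_pos.2 h0)⟩ else base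
  have hx (ζ : ℂ) : Tendsto (fun ε => (H (x ζ ε)).toEuclidean) (𝓝[>] 0)
      (𝓝 (WithLp.toLp 2 (f ζ, (0 : ℝ)))) := by
    refine tendsto_toEuclidean_of_isBoundaryExtension hb hf ζ ?_
    have h1 : Tendsto (fun ε : ℝ => (ζ, a * ε)) (𝓝[>] 0) (𝓝 (ζ, 0)) := by
      have : Continuous fun ε : ℝ => (ζ, a * ε) := by fun_prop
      simpa using (this.tendsto 0).mono_left nhdsWithin_le_nhds
    refine h1.congr' ?_
    filter_upwards [self_mem_nhdsWithin] with ε hε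
    simp [x, Set.mem_Ioi.1 hε]
  have hy : Tendsto (fun ε => (H (y ε)).toBall) (𝓝[>] 0)
      (𝓝 (OnePoint.infty : OnePoint (ℂ × ℝ))) := by
    have h1 : Tendsto y (𝓝[>] 0)
        (comap H3.toBall (𝓝 (RiemannSphere.toBall OnePoint.infty))) := by
      refine tendsto_comap_iff.2 ?_
      have h2 : Tendsto (fun ε : ℝ => (c, a * ε⁻¹)) (𝓝[>] 0) (coclosedCompact (ℂ × ℝ)) := by
        rw [coclosedCompact_eq_cocompact]
        refine tendsto_cocompact_of_tendsto_dist_comp_atTop (0 : ℂ × ℝ) ?_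
        have h3 : Tendsto (fun ε : ℝ => a * ε⁻¹) (𝓝[>] 0) atTop :=
          tendsto_inv_nhdsGT_zero.const_mul_atTop ha
        refine tendsto_atTop_mono (fun ε => ?_) h3
        rw [dist_zero_right]
        exact (le_abs_self _).trans (norm_snd_le (c, a * ε⁻¹))
      rw [← OnePoint.comap_coe_nhds_infty, tendsto_comap_iff] at h2
      refine Tendsto.congr' ?_ h2
      filter_upwards [self_mem_nhdsWithin] with ε hε
      simp [y, Set.mem_Ioi.1 hε, H3.toBall]
    have h2 := (hb OnePoint.infty).comp h1
    rw [hinfty] at h2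
    exact h2
  have hineq : ∀ᶠ ε in 𝓝[>] (0 : ℝ),
      dist (H (x z ε)).toEuclidean (H (x c ε)).toEuclidean *
          dist (H (x w ε)).toEuclidean (H (y ε)).toEuclidean ≤
        C * (dist (H (x w ε)).toEuclidean (H (x c ε)).toEuclidean *
          dist (H (x z ε)).toEuclidean (H (y ε)).toEuclidean) := by
    filter_upwards [Ioc_mem_nhdsGT (show (0 : ℝ) < 1 / 2 by norm_num)] with ε hε
    have h0 := hε.1
    -- The similarity with ratio `a` carrying `0` to `c` reduces to the normalised configuration.
    have hS (ζ : ℂ) : x ζ ε = similarity a ha c ⟨(ζ - c) / a, ε, h0⟩ := by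
      ext <;> simp [x, h0, similarity, mul_div_cancel₀, haC]
    have hSc : x c ε = similarity a ha c ⟨0, ε, h0⟩ := by
      rw [hS]; simp
    have hSy : y ε = similarity a ha c ⟨0, ε⁻¹, inv_pos.2 h0⟩ := by
      ext <;> simp [y, h0, similarity]
    rw [hS z, hS w, hSc, hSy]
    refine hC _ (isometry_similarity ha c) _ _ _ _ ?_ ?_
    · refine le_chord_of_norm_eq_one ?_ h0 hε.2
      rw [norm_div, Complex.norm_real, Real.norm_of_nonneg ha.le, ← ha', div_self ha.ne']
    · refine le_chord_of_norm_le_one ?_ h0 hε.2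
      rw [norm_div, Complex.norm_real, Real.norm_of_nonneg ha.le]
      exact div_le_one_of_le₀ hzw ha.le
  have hd (z₁ z₂ : ℂ) : dist (WithLp.toLp 2 (z₁, (0 : ℝ))) (WithLp.toLp 2 (z₂, (0 : ℝ))) =
      ‖z₁ - z₂‖ := by
    rw [WithLp.prod_dist_eq_of_L2]
    simp [dist_eq_norm]
  have hyw : Tendsto (fun ε => dist (H (x w ε)).toEuclidean (H (y ε)).toEuclidean) (𝓝[>] 0)
      atTop := by
    have h1 := tendsto_norm_of_tendsto_infty hy (WithLp.toLp 2 (f w, (0 : ℝ)))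
    have h2 := (hx w).dist (tendsto_const_nhds (x := WithLp.toLp 2 (f w, (0 : ℝ))))
    have h3 := tendsto_atTop_add_right_of_le' (𝓝[>] (0 : ℝ)) (-1) h1
      (g := fun ε => -dist (H (x w ε)).toEuclidean (WithLp.toLp 2 (f w, (0 : ℝ)))) (by
        rw [dist_self] at h2
        filter_upwards [h2.eventually_lt_const one_pos] with ε hε
        linarith)
    refine tendsto_atTop_mono (fun ε => ?_) h3
    have := dist_triangle_left (H (y ε)).toEuclidean (WithLp.toLp 2 (f w, (0 : ℝ)))
      (H (x w ε)).toEuclidean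
    linarith
  -- The parenthesis bounds the quotient of the distances from `H (y ε)` to the images of `x z ε`
  -- and `x w ε`; it tends to one since `H (y ε)` escapes.
  have hlim : Tendsto (fun ε => C * (dist (H (x w ε)).toEuclidean (H (x c ε)).toEuclidean *
      (1 + dist (H (x z ε)).toEuclidean (H (x w ε)).toEuclidean /
        dist (H (x w ε)).toEuclidean (H (y ε)).toEuclidean))) (𝓝[>] 0)
      (𝓝 (C * (‖f w - f c‖ * (1 + 0)))) := by
    rw [← hd]
    exact (((hx w).dist (hx c)).mul
      ((((hx z).dist (hx w)).div_atTop hyw).const_add 1)).const_mul C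
  rw [add_zero, mul_one] at hlim
  rw [← hd]
  refine le_of_tendsto_of_tendsto ((hx z).dist (hx c)) hlim ?_
  filter_upwards [hineq, hyw.eventually_gt_atTop 0] with ε h1 h2
  have h3 := dist_triangle (H (x z ε)).toEuclidean (H (x w ε)).toEuclidean (H (y ε)).toEuclidean
  refine le_of_mul_le_mul_right (h1.trans ?_) h2
  have h4 : 0 ≤ dist (H (x w ε)).toEuclidean (H (x c ε)).toEuclidean := dist_nonneg
  calc _ ≤ C * (dist (H (x w ε)).toEuclidean (H (x c ε)).toEuclidean *
        (dist (H (x z ε)).toEuclidean (H (x w ε)).toEuclidean +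
          dist (H (x w ε)).toEuclidean (H (y ε)).toEuclidean)) := by gcongr
    _ = _ := by field_simp; ring

/-! ### The length-area method -/

/-- A homeomorphism of the sphere which fixes `∞` restricts to one of the plane. -/
theorem exists_homeomorph_of_map_infty {h : RiemannSphere ≃ₜ RiemannSphere}
    (hinfty : h OnePoint.infty = OnePoint.infty) {f : ℂ → ℂ}
    (hf : ∀ z : ℂ, h (z : RiemannSphere) = (f z : RiemannSphere)) : ∃ F : ℂ ≃ₜ ℂ, ⇑F = f := by
  have h1 : IsOpenEmbedding f := by
    refine IsOpenEmbedding.of_comp f (OnePoint.isOpenEmbedding_coe (X := ℂ)) ?_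
    have : ((↑) : ℂ → RiemannSphere) ∘ f = h ∘ (↑) := funext fun z => (hf z).symm
    rw [this]
    exact h.isOpenEmbedding.comp OnePoint.isOpenEmbedding_coe
  have h2 : Function.Surjective f := by
    intro w
    have hw : h.symm w ≠ OnePoint.infty := by
      intro e
      rw [h.symm_apply_eq, hinfty] at e
      exact OnePoint.coe_ne_infty w e
    obtain ⟨z, hz⟩ := OnePoint.ne_infty_iff_exists.1 hw
    refine ⟨z, OnePoint.coe_injective ?_⟩
    rw [← hf, hz, h.apply_symm_apply]
  exact ⟨(Equiv.ofBijective f ⟨h1.injective, h2⟩).toHomeomorphOfIsInducing h1.isInducing, rfl⟩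

/-- The image of a disc contains every concentric disc disjoint from the image of the circle. -/
theorem Homeomorph.ball_subset_image_ball (F : ℂ ≃ₜ ℂ) {c : ℂ} {r s : ℝ} (hr : 0 < r)
    (hs : ∀ w, dist w c = r → s ≤ dist (F w) (F c)) :
    Metric.ball (F c) s ⊆ F '' Metric.ball c r := by
  intro u hu
  refine ⟨F.symm u, ?_, F.apply_symm_apply u⟩
  by_contra hn
  rw [Metric.mem_ball, not_lt] at hn
  have hs0 : 0 < s := dist_nonneg.trans_lt (Metric.mem_ball.1 hu)
  have hcont : ContinuousOn (fun v => dist (F.symm v) c) (Metric.ball (F c) s) :=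
    (F.symm.continuous.dist continuous_const).continuousOn
  -- If the preimage of `u` lay outside the disc, some point of the connected ball would have its
  -- preimage on the circle.
  obtain ⟨v, hv, hvr⟩ := (convex_ball (F c) s).isPreconnected.intermediate_value
    (Metric.mem_ball_self hs0) hu hcont (show r ∈ Set.Icc _ _ by
      simpa using ⟨hr.le, hn⟩)
  have := hs _ hvr
  rw [F.apply_symm_apply] at this
  exact this.not_gt hv

theorem MeasurableSet.reProdIm {s t : Set ℝ} (hs : MeasurableSet s) (ht : MeasurableSet t) :
    MeasurableSet (s ×ℂ t) :=
  (Complex.measurable_re hs).inter (Complex.measurable_im ht)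

/-- The pullback of Lebesgue measure by a homeomorphism of the plane. -/
noncomputable def Homeomorph.areaMeasure (F : ℂ ≃ₜ ℂ) : Measure ℂ := volume.map F.symm

theorem Homeomorph.areaMeasure_apply (F : ℂ ≃ₜ ℂ) (s : Set ℂ) :
    F.areaMeasure s = volume (F '' s) := by
  rw [Homeomorph.areaMeasure, ← F.symm.toMeasurableEquiv_coe, MeasurableEquiv.map_apply]
  congr 1
  exact (F.toEquiv.image_eq_preimage_symm s).symm

theorem Homeomorph.areaMeasure_lt_top (F : ℂ ≃ₜ ℂ) {s : Set ℂ} (hs : Bornology.IsBounded s) :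
    F.areaMeasure s < ⊤ := by
  refine (measure_mono subset_closure).trans_lt ?_
  rw [F.areaMeasure_apply]
  exact (hs.isCompact_closure.image F.continuous).measure_lt_top

/-- The area of the image of a disc is bounded below by the squared size of the image of a
diameter. -/
theorem Homeomorph.dist_sq_le_areaMeasure_ball (F : ℂ ≃ₜ ℂ) {C : ℝ} (hC : 0 < C)
    (hF : ∀ c z w : ℂ, ‖z - c‖ ≤ ‖w - c‖ → ‖F z - F c‖ ≤ C * ‖F w - F c‖)
    {c a b : ℂ} {r : ℝ} (ha : dist a c = r) (hb : dist b c = r) :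
    dist (F a) (F b) ^ 2 ≤ 4 * C ^ 2 * F.areaMeasure.real (Metric.ball c r) := by
  have hr : 0 ≤ r := ha ▸ dist_nonneg
  rcases hr.eq_or_lt with hr | hr
  · rw [← hr, dist_eq_zero] at ha hb
    rw [ha, hb, dist_self]
    simpa using by positivity
  have hs (w : ℂ) (hw : dist w c = r) : dist (F a) (F b) / (2 * C) ≤ dist (F w) (F c) := by
    have h1 := hF c a w (by rw [← dist_eq_norm, ← dist_eq_norm, ha, hw])
    have h2 := hF c b w (by rw [← dist_eq_norm, ← dist_eq_norm, hb, hw])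
    rw [← dist_eq_norm, ← dist_eq_norm] at h1 h2
    rw [div_le_iff₀ (by positivity)]
    linarith [dist_triangle_right (F a) (F b) (F c)]
  have h1 := measure_mono (μ := volume) (F.ball_subset_image_ball hr hs)
  have hfin := F.areaMeasure_lt_top (Metric.isBounded_ball (x := c) (r := r))
  rw [Complex.volume_ball, ← F.areaMeasure_apply] at h1
  have h2 := ENNReal.toReal_mono hfin.ne h1
  rw [ENNReal.toReal_mul, ENNReal.toReal_pow, ENNReal.toReal_ofReal (by positivity)] at h2
  have hpi : (((NNReal.pi : NNReal) : ENNReal)).toReal = Real.pi := rfl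
  rw [hpi, div_pow, mul_pow, div_mul_eq_mul_div, div_le_iff₀ (by positivity)] at h2
  change _ ≤ 4 * C ^ 2 * (F.areaMeasure (Metric.ball c r)).toReal
  have h3 : (1 : ℝ) ≤ Real.pi := by linarith [Real.pi_gt_three]
  nlinarith [sq_nonneg (dist (F a) (F b))]

/-- A chain of tangent discs along a horizontal segment. -/
theorem Homeomorph.dist_sq_le_areaMeasure_rect (F : ℂ ≃ₜ ℂ) {C : ℝ} (hC : 0 < C)
    (hF : ∀ c z w : ℂ, ‖z - c‖ ≤ ‖w - c‖ → ‖F z - F c‖ ≤ C * ‖F w - F c‖)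
    {a b y δ : ℝ} (hab : a ≤ b) {n : ℕ} (hn : 0 < n) (hδ : (b - a) / n ≤ 2 * δ) :
    dist (F ⟨a, y⟩) (F ⟨b, y⟩) ^ 2 ≤
      n * (4 * C ^ 2 * F.areaMeasure.real (Set.Ioo a b ×ℂ Metric.closedBall y δ)) := by
  have hn' : (0 : ℝ) < n := by exact_mod_cast hn
  set ℓ := (b - a) / n with hℓ
  have hℓ0 : 0 ≤ ℓ := by have := sub_nonneg.2 hab; positivity
  have hnℓ : n * ℓ = b - a := by rw [hℓ]; field_simp
  let x (j : ℕ) : ℝ := a + j * ℓ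
  let B (j : ℕ) : Set ℂ := Metric.ball ⟨x j + ℓ / 2, y⟩ (ℓ / 2)
  have hB (j : ℕ) {z : ℂ} (hz : z ∈ B j) :
      (x j < z.re ∧ z.re < x j + ℓ) ∧ z.im ∈ Metric.closedBall y δ := by
    have hz' : ‖z - ⟨x j + ℓ / 2, y⟩‖ < ℓ / 2 := by rw [← dist_eq_norm]; exact hz
    have h1 := (Complex.abs_re_le_norm _).trans_lt hz'
    have h2 := (Complex.abs_im_le_norm _).trans_lt hz'
    rw [Complex.sub_re, abs_lt] at h1
    rw [Complex.sub_im] at h2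
    refine ⟨⟨by linarith [h1.1], by linarith [h1.2]⟩, ?_⟩
    rw [Metric.mem_closedBall, Real.dist_eq]
    exact h2.le.trans (by linarith)
  have hx1 (j : ℕ) : x (j + 1) = x j + ℓ := by simp only [x]; push_cast; ring
  have hstep (j : ℕ) : dist (F ⟨x j, y⟩) (F ⟨x (j + 1), y⟩) ^ 2 ≤
      4 * C ^ 2 * F.areaMeasure.real (B j) := by
    refine F.dist_sq_le_areaMeasure_ball hC hF ?_ ?_
    · rw [Complex.dist_of_im_eq (by rfl), Real.dist_eq, abs_sub_comm, add_sub_cancel_left,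
        abs_of_nonneg (by positivity)]
    · rw [Complex.dist_of_im_eq (by rfl), Real.dist_eq, hx1,
        show x j + ℓ - (x j + ℓ / 2) = ℓ / 2 by ring, abs_of_nonneg (by positivity)]
  have hmono {i j : ℕ} (hij : i < j) : x i + ℓ ≤ x j := by
    rw [← hx1]
    have : ((i + 1 : ℕ) : ℝ) ≤ j := by exact_mod_cast hij
    simp only [x]
    gcongr
  have hdisj : Set.PairwiseDisjoint (Finset.range n : Set ℕ) B := by
    intro i _ j _ hij
    refine Set.disjoint_left.2 fun z hi hj => ?_
    have h1 := (hB i hi).1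
    have h2 := (hB j hj).1
    rcases lt_or_gt_of_ne hij with h | h
    · linarith [hmono h]
    · linarith [hmono h]
  have hsub : (⋃ j ∈ Finset.range n, B j) ⊆ Set.Ioo a b ×ℂ Metric.closedBall y δ := by
    refine Set.iUnion₂_subset fun j hj z hz => ?_
    obtain ⟨⟨h1, h2⟩, h3⟩ := hB j hz
    have h4 := hmono (Finset.mem_range.1 hj)
    have h5 : x n = b := by simp only [x]; linarith
    have h6 : a ≤ x j := le_add_of_nonneg_right (by positivity)
    exact ⟨⟨by linarith, by linarith⟩, h3⟩
  have hfin : F.areaMeasure (Set.Ioo a b ×ℂ Metric.closedBall y δ) ≠ ⊤ :=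
    (F.areaMeasure_lt_top ((Metric.isBounded_Ioo a b).reProdIm Metric.isBounded_closedBall)).ne
  have hsum : ∑ j ∈ Finset.range n, F.areaMeasure.real (B j) ≤
      F.areaMeasure.real (Set.Ioo a b ×ℂ Metric.closedBall y δ) := by
    rw [← measureReal_biUnion_finset hdisj (fun j _ => Metric.isOpen_ball.measurableSet)
      (fun j _ => (F.areaMeasure_lt_top Metric.isBounded_ball).ne)]
    exact measureReal_mono hsub hfin
  have htri := dist_le_range_sum_dist (fun j => F ⟨x j, y⟩) n
  have hx0 : x 0 = a := by simp [x]
  have hxn : x n = b := by simp only [x]; linarith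
  simp only [hx0, hxn] at htri
  -- Triangle inequality, then Cauchy–Schwarz over the `n` discs, whose image areas add up by
  -- disjointness.
  calc dist (F ⟨a, y⟩) (F ⟨b, y⟩) ^ 2
      ≤ (∑ j ∈ Finset.range n, dist (F ⟨x j, y⟩) (F ⟨x (j + 1), y⟩)) ^ 2 := by gcongr
    _ ≤ n * ∑ j ∈ Finset.range n, dist (F ⟨x j, y⟩) (F ⟨x (j + 1), y⟩) ^ 2 := by
      simpa using sq_sum_le_card_mul_sum_sq (s := Finset.range n)
        (f := fun j => dist (F ⟨x j, y⟩) (F ⟨x (j + 1), y⟩))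
    _ ≤ n * ∑ j ∈ Finset.range n, 4 * C ^ 2 * F.areaMeasure.real (B j) := by
      gcongr with j
      exact hstep j
    _ ≤ _ := by
      rw [← Finset.mul_sum]
      gcongr

/-- The length-area estimate for finitely many disjoint segments of a horizontal line. -/
theorem Homeomorph.sum_dist_sq_le_areaMeasure_strip (F : ℂ ≃ₜ ℂ) {C : ℝ} (hC : 0 < C)
    (hF : ∀ c z w : ℂ, ‖z - c‖ ≤ ‖w - c‖ → ‖F z - F c‖ ≤ C * ‖F w - F c‖)
    {y δ : ℝ} (hδ : 0 < δ) {m : ℕ} {I : ℕ → ℝ × ℝ}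
    (hI : (m, I) ∈ AbsolutelyContinuousOnInterval.disjWithin 0 1) :
    (∑ i ∈ Finset.range m, dist (F ⟨(I i).1, y⟩) (F ⟨(I i).2, y⟩)) ^ 2 ≤
      ((∑ i ∈ Finset.range m, dist (I i).1 (I i).2) / (2 * δ) + m) *
        (4 * C ^ 2 * F.areaMeasure.real (Set.Icc 0 1 ×ℂ Metric.closedBall y δ)) := by
  let R (i : ℕ) : Set ℂ := Set.Ioo (min (I i).1 (I i).2) (max (I i).1 (I i).2) ×ℂ
    Metric.closedBall y δ
  -- Enough discs of radius at most `δ`. The `+ 1` keeps the number positive and produces the term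
  -- `m` in the bound.
  let n (i : ℕ) : ℕ := ⌊dist (I i).1 (I i).2 / (2 * δ)⌋₊ + 1
  have hn0 (i : ℕ) : (0 : ℝ) < n i := by positivity
  have hn (i : ℕ) : (n i : ℝ) ≤ dist (I i).1 (I i).2 / (2 * δ) + 1 := by
    simp only [n]
    push_cast
    gcongr
    exact Nat.floor_le (by positivity)
  have hstep (i : ℕ) : dist (F ⟨(I i).1, y⟩) (F ⟨(I i).2, y⟩) ^ 2 / n i ≤
      4 * C ^ 2 * F.areaMeasure.real (R i) := by
    rw [div_le_iff₀' (hn0 i)]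
    have h1 : (max (I i).1 (I i).2 - min (I i).1 (I i).2) / n i ≤ 2 * δ := by
      rw [max_sub_min_eq_abs', ← Real.dist_eq, div_le_iff₀ (hn0 i), ← div_le_iff₀' (by positivity)]
      simp only [n]
      push_cast
      exact (Nat.lt_floor_add_one _).le
    have h2 := F.dist_sq_le_areaMeasure_rect hC hF (y := y) min_le_max (Nat.succ_pos _) h1
    refine le_of_eq_of_le ?_ h2
    rcases le_total (I i).1 (I i).2 with h | h
    · rw [min_eq_left h, max_eq_right h]
    · rw [min_eq_right h, max_eq_left h, dist_comm]
  have hsub1 {i : ℕ} : R i ⊆ Set.uIoc (I i).1 (I i).2 ×ℂ Metric.closedBall y δ :=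
    fun z hz => ⟨Set.Ioo_subset_Ioc_self hz.1, hz.2⟩
  have hdisj : Set.PairwiseDisjoint (Finset.range m : Set ℕ) R := by
    intro i hi j hj hij
    exact Set.disjoint_left.2 fun z h1 h2 =>
      Set.disjoint_left.1 (hI.2 hi hj hij) (hsub1 h1).1 (hsub1 h2).1
  have hsub : (⋃ i ∈ Finset.range m, R i) ⊆ Set.Icc 0 1 ×ℂ Metric.closedBall y δ := by
    refine Set.iUnion₂_subset fun i hi z hz => ⟨?_, hz.2⟩
    have h1 := AbsolutelyContinuousOnInterval.uIoc_subset_of_mem_disjWithin hI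
      (Finset.mem_range.1 hi) (hsub1 hz).1
    rw [Set.uIoc_of_le zero_le_one] at h1
    exact Set.Ioc_subset_Icc_self h1
  have hsum : ∑ i ∈ Finset.range m, F.areaMeasure.real (R i) ≤
      F.areaMeasure.real (Set.Icc 0 1 ×ℂ Metric.closedBall y δ) := by
    rw [← measureReal_biUnion_finset hdisj
      (fun i _ => measurableSet_Ioo.reProdIm measurableSet_closedBall)
      (fun i _ => (F.areaMeasure_lt_top
        ((Metric.isBounded_Ioo _ _).reProdIm Metric.isBounded_closedBall)).ne)]
    exact measureReal_mono hsub
      (F.areaMeasure_lt_top ((Metric.isBounded_Icc 0 1).reProdIm Metric.isBounded_closedBall)).ne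
  rcases m.eq_zero_or_pos with hm | hm
  · subst hm; simp
  have hpos : 0 < ∑ i ∈ Finset.range m, (n i : ℝ) :=
    Finset.sum_pos (fun i _ => hn0 i) ⟨0, Finset.mem_range.2 hm⟩
  have hCS := Finset.sq_sum_div_le_sum_sq_div (Finset.range m)
    (fun i => dist (F ⟨(I i).1, y⟩) (F ⟨(I i).2, y⟩)) (g := fun i => (n i : ℝ)) fun i _ => hn0 i
  rw [div_le_iff₀' hpos] at hCS
  refine hCS.trans (mul_le_mul ?_ ?_ (Finset.sum_nonneg fun i _ => by positivity) (by positivity))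
  · refine (Finset.sum_le_sum fun i _ => hn i).trans_eq ?_
    rw [Finset.sum_add_distrib, Finset.sum_div]
    simp
  · refine (Finset.sum_le_sum fun i _ => hstep i).trans ?_
    rw [← Finset.mul_sum]
    gcongr

/-! ### Absolute continuity on almost every line -/

/-- The distribution of the area of the image of the strip over `[0, 1]`. -/
noncomputable def Homeomorph.stripMeasure (F : ℂ ≃ₜ ℂ) : Measure ℝ :=
  (F.areaMeasure.restrict (Complex.re ⁻¹' Set.Icc 0 1)).map Complex.im

theorem Homeomorph.stripMeasure_apply (F : ℂ ≃ₜ ℂ) {s : Set ℝ} (hs : MeasurableSet s) :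
    F.stripMeasure s = F.areaMeasure (Set.Icc 0 1 ×ℂ s) := by
  rw [stripMeasure, Measure.map_apply Complex.measurable_im hs,
    Measure.restrict_apply (Complex.measurable_im hs), Set.inter_comm]
  rfl

theorem Homeomorph.isLocallyFiniteMeasure_stripMeasure (F : ℂ ≃ₜ ℂ) :
    IsLocallyFiniteMeasure F.stripMeasure := by
  refine ⟨fun y => ⟨Metric.closedBall y 1, Metric.closedBall_mem_nhds y one_pos, ?_⟩⟩
  rw [F.stripMeasure_apply measurableSet_closedBall]
  exact F.areaMeasure_lt_top ((Metric.isBounded_Icc 0 1).reProdIm Metric.isBounded_closedBall)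

/-- On almost every line the area of thin strips is at most proportional to their width. -/
theorem Homeomorph.ae_exists_areaMeasure_strip_le (F : ℂ ≃ₜ ℂ) :
    ∀ᵐ y : ℝ, ∃ M : ℝ, 0 ≤ M ∧ ∀ᶠ δ in 𝓝[>] (0 : ℝ),
      F.areaMeasure.real (Set.Icc 0 1 ×ℂ Metric.closedBall y δ) ≤ M * (2 * δ) := by
  have := F.isLocallyFiniteMeasure_stripMeasure
  filter_upwards [Besicovitch.ae_tendsto_rnDeriv F.stripMeasure volume,
    F.stripMeasure.rnDeriv_lt_top volume] with y hy hlt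
  -- Any finite bound strictly above the density eventually dominates the quotients. A singular part
  -- of the strip measure does no harm.
  obtain ⟨M, hM1, hM2⟩ := ENNReal.lt_iff_exists_nnreal_btwn.1 hlt
  refine ⟨M, M.2, ?_⟩
  filter_upwards [hy.eventually_lt_const hM1, self_mem_nhdsWithin] with δ h1 h2
  rw [Set.mem_Ioi] at h2
  rw [F.stripMeasure_apply measurableSet_closedBall, Real.volume_closedBall] at h1
  have h3 := ENNReal.toReal_mono ENNReal.coe_ne_top h1.le
  rw [ENNReal.toReal_div, ENNReal.toReal_ofReal (by positivity), div_le_iff₀ (by positivity)] at h3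
  exact h3

/-- Weakly quasisymmetric homeomorphisms are absolutely continuous on almost every line. -/
theorem Homeomorph.ae_absolutelyContinuousOnInterval (F : ℂ ≃ₜ ℂ) {C : ℝ} (hC : 0 < C)
    (hF : ∀ c z w : ℂ, ‖z - c‖ ≤ ‖w - c‖ → ‖F z - F c‖ ≤ C * ‖F w - F c‖) :
    ∀ᵐ y : ℝ, AbsolutelyContinuousOnInterval (fun x : ℝ => F ⟨x, y⟩) 0 1 := by
  filter_upwards [F.ae_exists_areaMeasure_strip_le] with y hy
  obtain ⟨M, hM, hy⟩ := hy
  have key : ∀ m I, (m, I) ∈ AbsolutelyContinuousOnInterval.disjWithin 0 1 →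
      (∑ i ∈ Finset.range m, dist (F ⟨(I i).1, y⟩) (F ⟨(I i).2, y⟩)) ^ 2 ≤
        4 * C ^ 2 * M * ∑ i ∈ Finset.range m, dist (I i).1 (I i).2 := by
    intro m I hI
    set S := ∑ i ∈ Finset.range m, dist (I i).1 (I i).2
    have hS : 0 ≤ S := Finset.sum_nonneg fun i _ => dist_nonneg
    -- The strip estimate holds for every small `δ`; in the limit the dependence on the number `m`
    -- of intervals disappears.
    have hlim : Tendsto (fun δ : ℝ => 4 * C ^ 2 * M * (S + m * (2 * δ))) (𝓝[>] 0)
        (𝓝 (4 * C ^ 2 * M * S)) := by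
      have : Continuous fun δ : ℝ => 4 * C ^ 2 * M * (S + m * (2 * δ)) := by fun_prop
      simpa using (this.tendsto 0).mono_left nhdsWithin_le_nhds
    refine ge_of_tendsto hlim ?_
    filter_upwards [hy, self_mem_nhdsWithin] with δ h1 h2
    rw [Set.mem_Ioi] at h2
    calc _ ≤ _ := F.sum_dist_sq_le_areaMeasure_strip hC hF h2 hI
      _ ≤ (S / (2 * δ) + m) * (4 * C ^ 2 * (M * (2 * δ))) := by gcongr
      _ = _ := by field_simp
  rw [absolutelyContinuousOnInterval_iff]
  intro ε hε
  -- The `+ 1` allows for `M = 0`.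
  refine ⟨ε ^ 2 / (4 * C ^ 2 * M + 1), by positivity, fun E hE hlt => ?_⟩
  have h1 := key E.1 E.2 hE
  rw [lt_div_iff₀ (by positivity)] at hlt
  have h2 : 0 ≤ ∑ i ∈ Finset.range E.1, dist (E.2 i).1 (E.2 i).2 :=
    Finset.sum_nonneg fun i _ => dist_nonneg
  exact lt_of_pow_lt_pow_left₀ 2 hε.le (by nlinarith)

/-! ### Fubini and the conclusion -/

/-- **Fubini** for null sets of the plane. -/
theorem Complex.volume_eq_zero_iff_ae_line {s : Set ℂ} (hs : MeasurableSet s) :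
    volume s = 0 ↔ ∀ᵐ y : ℝ, ∀ᵐ x : ℝ, (⟨x, y⟩ : ℂ) ∉ s := by
  have h1 := Complex.volume_preserving_equiv_real_prod.symm.measure_preimage_equiv s
  rw [← h1, Measure.volume_eq_prod,
    Measure.prod_apply_symm (Complex.measurableEquivRealProd.symm.measurable hs), lintegral_eq_zero_iff (measurable_measure_prodMk_right
      (Complex.measurableEquivRealProd.symm.measurable hs))]
  refine eventually_congr (Eventually.of_forall fun y => ?_)
  rw [ae_iff]
  simp only [not_not]
  rfl

theorem hasLineDerivAt_one_iff {f : ℂ → ℂ} {x y : ℝ} {c : ℂ} :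
    HasLineDerivAt ℝ f c ⟨x, y⟩ 1 ↔ HasDerivAt (fun x : ℝ => f ⟨x, y⟩) c x := by
  have h (t : ℝ) : (⟨x, y⟩ : ℂ) + t • (1 : ℂ) = ⟨x + t, y⟩ := by
    apply Complex.ext <;> simp
  simp only [HasLineDerivAt, h]
  constructor
  · intro hd
    have hd' : HasDerivAt (fun t : ℝ => f ⟨x + t, y⟩) c (x - x) := by rwa [sub_self]
    simpa using hd'.comp_sub_const x x
  · intro hd
    have hd' : HasDerivAt (fun x : ℝ => f ⟨x, y⟩) c (x + 0) := by rwa [add_zero]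
    exact hd'.comp_const_add x 0

theorem measurableSet_unitSquare : MeasurableSet unitSquare :=
  measurableSet_Icc.reProdIm measurableSet_Icc

theorem mainTheorem11
    (H : Equiv.Perm H3) (h : RiemannSphere ≃ₜ RiemannSphere) (hHh : IsEquivariantPair H h)
    (hinfty : h OnePoint.infty = OnePoint.infty)
    (f : ℂ → ℂ) (hf : ∀ z : ℂ, h (z : RiemannSphere) = (f z : RiemannSphere)) :
    volume {z ∈ unitSquare | ¬ ∃ c : ℂ, HasLineDerivAt ℝ f c z 1} = 0 ∧
      0 < volume {z ∈ unitSquare | ∃ c : ℂ, c ≠ 0 ∧ HasLineDerivAt ℝ f c z 1} := by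
  obtain ⟨C, hC0, hC⟩ := hHh.exists_norm_sub_le hinfty hf
  obtain ⟨F, rfl⟩ := exists_homeomorph_of_map_infty hinfty hf
  have hAC := F.ae_absolutelyContinuousOnInterval (C := C + 1) (by positivity)
    fun c z w hzw => (hC c z w hzw).trans (by gcongr; linarith)
  have hdiff : ∀ᵐ y : ℝ, ∀ᵐ x : ℝ, x ∈ Set.Icc (0 : ℝ) 1 →
      ∃ c, HasLineDerivAt ℝ F c ⟨x, y⟩ 1 := by
    -- Absolute continuity gives bounded variation, hence a derivative almost everywhere.
    filter_upwards [hAC] with y hy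
    filter_upwards [hy.boundedVariationOn.ae_differentiableAt_of_mem_uIcc] with x hx hx01
    rw [Set.uIcc_of_le zero_le_one] at hx
    exact ⟨_, hasLineDerivAt_one_iff.2 (hx hx01).hasDerivAt⟩
  have hmeas : MeasurableSet {z : ℂ | ∃ c, HasLineDerivAt ℝ F c z 1} := by
    convert measurableSet_lineDifferentiableAt (𝕜 := ℝ) (v := (1 : ℂ)) F.continuous using 3 with z
    exact ⟨fun ⟨c, hc⟩ => hc.lineDifferentiableAt, fun hz => ⟨_, hz.hasLineDerivAt⟩⟩
  refine ⟨?_, ?_⟩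
  · refine (Complex.volume_eq_zero_iff_ae_line
      (measurableSet_unitSquare.inter hmeas.compl)).2 ?_
    filter_upwards [hdiff] with y hy
    filter_upwards [hy] with x hx hmem
    exact hmem.2 (hx hmem.1.1)
  · rw [pos_iff_ne_zero]
    intro h0
    have hmeas' : MeasurableSet {z ∈ unitSquare | ∃ c : ℂ, c ≠ 0 ∧ HasLineDerivAt ℝ F c z 1} := by
      have hd := measurable_lineDeriv (𝕜 := ℝ) (v := (1 : ℂ)) F.continuous
      convert measurableSet_unitSquare.inter
        (hmeas.inter (hd (measurableSet_singleton (0 : ℂ)).compl)) using 1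
      ext z
      refine and_congr_right fun _ => ⟨fun ⟨c, hc, hd⟩ => ⟨⟨c, hd⟩, ?_⟩, fun ⟨⟨c, hd⟩, hc⟩ =>
        ⟨c, ?_, hd⟩⟩
      · simpa [hd.lineDeriv] using hc
      · simpa [hd.lineDeriv] using hc
    rw [Complex.volume_eq_zero_iff_ae_line hmeas'] at h0
    -- On almost every line meeting the square the derivative would vanish almost everywhere, so `F`
    -- would identify the two ends of the segment. Hence almost no line could meet the square.
    have hconst : ∀ᵐ y : ℝ, y ∉ Set.Icc (0 : ℝ) 1 := by
      filter_upwards [hAC, hdiff, h0] with y h1 h2 h3 hy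
      obtain ⟨K, hK⟩ := h1.const_of_ae_hasDerivAt_zero (by
        filter_upwards [h2, h3] with x h4 h5 hx
        rw [Set.uIcc_of_le zero_le_one] at hx
        obtain ⟨c, hc⟩ := h4 hx
        have hc0 : c = 0 := by
          by_contra hne
          exact h5 ⟨⟨hx, hy⟩, c, hne, hc⟩
        rw [← hc0]
        exact hasLineDerivAt_one_iff.1 hc)
      have h6 : F ⟨0, y⟩ = F ⟨1, y⟩ := (hK 0 (by simp)).trans (hK 1 (by simp)).symm
      exact zero_ne_one (congrArg Complex.re (F.injective h6))
    have hvol : volume (Set.Icc (0 : ℝ) 1) = 0 := by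
      simp only [ae_iff, not_not] at hconst
      exact hconst
    simp at hvol
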